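/- Let $m\ge 1$ and let $F=(f_1,\dots,f_m):\mathbb{R}^n\to\mathbb{R}^m$ be continuously differentiable. Write $u\le v$ for the componentwise order on $\mathbb{R}^m$; a point $x$ dominates $y$ if $F(x)\le F(y)$ and $F(x)\ne F(y)$; a set is mutually nondominated if none of its points dominates another. Put $\mathcal{D}(x,d)=\max_{j}\nabla f_j(x)^\top d$. For nonempty $I\subseteq\{1,\dots,m\}$ let $$\theta^I(x)=\min_{d\in\mathbb{R}^n}\Big(\max_{j\in I}\nabla f_j(x)^\top d+\tfrac12\|d\|^2\Big),$$ let $v^I(x)$ be its unique minimizer, and let $\theta,v$ be $\theta^I,v^I$ for $I=\{1,\dots,m\}$. A point $x$ is Pareto-stationary if $\min_{d\in\mathbb{R}^n}\max_j\nabla f_j(x)^\top d=0$. A direction $d$ is a common descent direction at $x$ if, for every $j$, $f_j(x+td)<f_j(x)$ for all sufficiently small $t>0$. The Front Descent method has parameters $\alpha_0>0$, $\delta,\gamma\in(0,1)$, $\Gamma_1,\Gamma_2>0$, $\sigma_k\ge 0$, and starts from a finite mutually nondominated set $X^0$. At iteration $k$ one sets $\hat X=X^k$ and scans the points $x_c$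 of $X^k$ one after the other. If $x_c$ still belongs to $\hat X$ when its turn comes, it is processed as follows (otherwise it is skipped). (1) Refinement. If $\theta(x_c)<-\sigma_k$, an arbitrary common descent direction $v_D$ at $x_c$ is computed. Put $d=v_D$ if $\mathcal{D}(x_c,v_D)\le-\Gamma_1\|v(x_c)\|^2$ and $\|v_D\|\le\Gamma_2\|v(x_c)\|$, and $d=v(x_c)$ otherwise. Let $z=x_c+\alpha d$, where $\alpha$ is the largest number of the form $\alpha_0\delta^h$, $h\in\mathbb{N}$, with $f_j(x_c+\alpha d)\le f_j(x_c)+\gamma\alpha\mathcal{D}(x_c,d)$ for all $j$. If $\theta(x_c)\ge-\sigma_k$, put $z=x_c$. Remove from $\hat X$ all points dominated by $z$ and add $z$. (2) Exploration. For each nonempty $I\subsetneq\{1,\dots,m\}$ with $\theta^I(z)<0$, in some order: if $z\in\hat X$, let $\alpha$ be the largest number of the form $\alpha_0\delta^h$, $h\in\mathbb{N}$, such that for every $y\in\hat X$ there is $j$ with $f_j(z+\alpha v^I(z))<f_j(y)$; remove from $\hat X$ all points dominated by $z+\alpha v^I(z)$ and add $z+\alpha v^I(z)$. When all points of $X^k$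 have been scanned, $X^{k+1}=\hat X$. Suppose that there is $x_0\in X^0$ such that $\bigcup_{j=1}^m\{x\in\mathbb{R}^n: f_j(x)\le f_j(x_0)\}$ is compact, that at each iteration $k$ the first point to be processed belongs to $\operatorname{argmin}_{x\in X^k}\theta(x)$, and that $\sigma_k\to0$. Let $\{X^k\}$ be an infinite sequence of sets produced by the method, and let $\{x^k\}$ be any sequence with $x^k\in X^k$ for all $k$. Then $\{x^k\}$ has accumulation points, and every accumulation point of $\{x^k\}$ is Pareto-stationary. -/

import Mathlib

open Filter Topology
open scoped Gradient

namespace FrontDescent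

/-- Decision space `ℝⁿ` with its Euclidean norm. -/
abbrev E (n : ℕ) : Type := EuclideanSpace ℝ (Fin n)

variable {n m : ℕ}

/-- `x` dominates `y`: `F x ≤ F y` componentwise and `F x ≠ F y`. -/
def Dominates (F : E n → Fin m → ℝ) (x y : E n) : Prop :=
  F x ≤ F y ∧ F x ≠ F y

/-- No point of `X` dominates another point of `X`. -/
def MutuallyNondominated (F : E n → Fin m → ℝ) (X : Set (E n)) : Prop :=
  ∀ x ∈ X, ∀ y ∈ X, ¬ Dominates F x y

/-- The gradient of the `j`-th objective at `x`. -/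
noncomputable def grad (F : E n → Fin m → ℝ) (j : Fin m) (x : E n) : E n :=
  gradient (fun y => F y j) x

/-- `max_{j ∈ I} ∇f_j(x)ᵀ d`, for nonempty `I` (the value for `I = ∅` is `0`, never used). -/
noncomputable def maxSlope (F : E n → Fin m → ℝ) (I : Finset (Fin m)) (x d : E n) : ℝ :=
  ⨆ j : I, inner ℝ (grad F j x) d

/-- `𝒟(x, d) = max_{j = 1, …, m} ∇f_j(x)ᵀ d`. -/
noncomputable def slope (F : E n → Fin m → ℝ) (x d : E n) : ℝ :=
  maxSlope F Finset.univ x d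

/-- Pareto-stationarity: `min_{d ∈ ℝⁿ} max_j ∇f_j(x)ᵀ d = 0`. -/
def ParetoStationary (F : E n → Fin m → ℝ) (x : E n) : Prop :=
  IsLeast (Set.range (slope F x)) 0

/-- Objective function of the (partial) steepest descent direction problem. -/
noncomputable def sdObjective (F : E n → Fin m → ℝ) (I : Finset (Fin m)) (x d : E n) : ℝ :=
  maxSlope F I x d + 1 / 2 * ‖d‖ ^ 2

theorem continuous_maxSlope (F : E n → Fin m → ℝ) (I : Finset (Fin m)) (x : E n) :
    Continuous (maxSlope F I x) := by
  unfold maxSlope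
  rcases isEmpty_or_nonempty I with hI | hI
  · simp only [Real.iSup_of_isEmpty]
    exact continuous_const
  · have h : (fun d : E n => ⨆ j : I, inner ℝ (grad F j x) d) =
        fun d => Finset.univ.sup' Finset.univ_nonempty
          (fun j : I => inner ℝ (grad F j x) d) := by
      funext d
      rw [Finset.sup'_univ_eq_ciSup]
    rw [h]
    exact Continuous.finset_sup'_apply _ (fun j _ => by fun_prop)

theorem le_maxSlope (F : E n → Fin m → ℝ) {I : Finset (Fin m)} (x d : E n) (j : I) :
    inner ℝ (grad F j x) d ≤ maxSlope F I x d :=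
  le_ciSup (f := fun j : I => inner ℝ (grad F j x) d) (Set.finite_range _).bddAbove j

theorem exists_sdObjective_min (F : E n → Fin m → ℝ) (I : Finset (Fin m)) (x : E n) :
    ∃ v : E n, ∀ d : E n, sdObjective F I x v ≤ sdObjective F I x d := by
  have hc : Continuous (sdObjective F I x) := by
    unfold sdObjective
    exact (continuous_maxSlope F I x).add (by fun_prop)
  obtain ⟨C, hC⟩ : ∃ C : ℝ, ∀ d : E n, -C * ‖d‖ ≤ maxSlope F I x d := by
    rcases isEmpty_or_nonempty I with hI | hI
    · exact ⟨0, fun d => by simp [maxSlope]⟩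
    · obtain ⟨j⟩ := hI
      refine ⟨‖grad F j x‖, fun d => le_trans ?_ (le_maxSlope F x d j)⟩
      have := abs_real_inner_le_norm (grad F j x) d
      linarith [neg_abs_le (inner ℝ (grad F j x) d)]
  refine hc.exists_forall_le ?_
  have h1 : Tendsto (fun d : E n => ‖d‖ * (1 / 2 * ‖d‖ - C)) (cocompact (E n)) atTop := by
    have h2 := tendsto_norm_cocompact_atTop (E := E n)
    refine h2.atTop_mul_atTop₀ ?_
    exact tendsto_atTop_add_const_right _ (-C) (h2.const_mul_atTop (by norm_num))
  refine tendsto_atTop_mono (fun d => ?_) h1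
  have := hC d
  unfold sdObjective
  nlinarith

/-- The steepest (partial) descent direction
`v^I(x) = argmin_d max_{j ∈ I} ∇f_j(x)ᵀ d + ½ ‖d‖²`. -/
noncomputable def sdDir (F : E n → Fin m → ℝ) (I : Finset (Fin m)) (x : E n) : E n :=
  Classical.choose (exists_sdObjective_min F I x)

theorem sdDir_min (F : E n → Fin m → ℝ) (I : Finset (Fin m)) (x d : E n) :
    sdObjective F I x (sdDir F I x) ≤ sdObjective F I x d :=
  Classical.choose_spec (exists_sdObjective_min F I x) d

/-- The minimizer is unique, so that `sdDir` is the argmin. -/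
theorem eq_sdDir (F : E n → Fin m → ℝ) (I : Finset (Fin m)) (x v : E n)
    (hv : ∀ d : E n, sdObjective F I x v ≤ sdObjective F I x d) : v = sdDir F I x := by
  set w := sdDir F I x with hw
  have h1 := hv ((1 / 2 : ℝ) • (v + w))
  have h2 : sdObjective F I x w ≤ sdObjective F I x v := sdDir_min F I x v
  have hconv : maxSlope F I x ((1 / 2 : ℝ) • (v + w)) ≤
      1 / 2 * (maxSlope F I x v + maxSlope F I x w) := by
    rcases isEmpty_or_nonempty I with hI | hI
    · simp [maxSlope]
    · refine ciSup_le (fun j => ?_)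
      rw [inner_smul_right, inner_add_right]
      linarith [le_maxSlope F x v j, le_maxSlope F x w j]
  have hpar := parallelogram_law_with_norm ℝ v w
  have hn : ‖(1 / 2 : ℝ) • (v + w)‖ = 1 / 2 * ‖v + w‖ := by
    rw [norm_smul]; norm_num
  unfold sdObjective at h1 h2
  rw [hn] at h1
  have h3 : ‖v - w‖ = 0 := by
    have : ‖v - w‖ * ‖v - w‖ ≤ 0 := by nlinarith
    nlinarith [norm_nonneg (v - w)]
  exact sub_eq_zero.mp (norm_eq_zero.mp h3)

/-- `θ^I(x) = min_d max_{j ∈ I} ∇f_j(x)ᵀ d + ½ ‖d‖²`. -/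
noncomputable def partialTheta (F : E n → Fin m → ℝ) (I : Finset (Fin m)) (x : E n) : ℝ :=
  ⨅ d : E n, sdObjective F I x d

/-- The infimum in the definition of `θ^I` is a minimum, attained at `v^I(x)`. -/
theorem partialTheta_eq (F : E n → Fin m → ℝ) (I : Finset (Fin m)) (x : E n) :
    partialTheta F I x = sdObjective F I x (sdDir F I x) := by
  refine le_antisymm (ciInf_le ⟨sdObjective F I x (sdDir F I x), ?_⟩ _)
    (le_ciInf (sdDir_min F I x))
  rintro _ ⟨d, rfl⟩
  exact sdDir_min F I x d

/-- The steepest common descent direction `v(x)`. -/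
noncomputable def commonDir (F : E n → Fin m → ℝ) (x : E n) : E n :=
  sdDir F Finset.univ x

/-- The stationarity measure `θ(x)`. -/
noncomputable def theta (F : E n → Fin m → ℝ) (x : E n) : ℝ :=
  partialTheta F Finset.univ x

/-- `d` is a descent direction at `x` for every objective. -/
def IsCommonDescentDir (F : E n → Fin m → ℝ) (x d : E n) : Prop :=
  ∀ j, ∀ᶠ t : ℝ in 𝓝[>] 0, F (x + t • d) j < F x j

/-- The numerical inputs of the method. -/
structure Params where
  α₀ : ℝ
  δ : ℝ
  γ : ℝ
  Γ₁ : ℝ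
  Γ₂ : ℝ
  σ : ℕ → ℝ
  α₀_pos : 0 < α₀
  δ_pos : 0 < δ
  δ_lt_one : δ < 1
  γ_pos : 0 < γ
  γ_lt_one : γ < 1
  Γ₁_pos : 0 < Γ₁
  Γ₂_pos : 0 < Γ₂
  σ_nonneg : ∀ k, 0 ≤ σ k

/-- The safeguard: the tentative direction `w` is steepest-descent-related at `x`. -/
def PassesTest (F : E n → Fin m → ℝ) (P : Params) (x w : E n) : Prop :=
  slope F x w ≤ -P.Γ₁ * ‖commonDir F x‖ ^ 2 ∧ ‖w‖ ≤ P.Γ₂ * ‖commonDir F x‖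

/-- `α = max_{h ∈ ℕ} {α₀ δ^h | the stepsize α₀ δ^h is acceptable}`. -/
def IsBacktrackingStep (P : Params) (acceptable : ℝ → Prop) (α : ℝ) : Prop :=
  IsGreatest {a : ℝ | ∃ h : ℕ, a = P.α₀ * P.δ ^ h ∧ acceptable a} α

/-- Sufficient decrease of all the objectives. -/
def Armijo (F : E n → Fin m → ℝ) (P : Params) (x d : E n) (a : ℝ) : Prop :=
  ∀ j, F (x + a • d) j ≤ F x j + P.γ * a * slope F x d

/-- `d` is the direction selected at `x`: an arbitrary common descent direction `w` is computed;
it is used if it passes the test, and is replaced by `v(x)` otherwise. -/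
def IsRefinementDir (F : E n → Fin m → ℝ) (P : Params) (x d : E n) : Prop :=
  ∃ w, IsCommonDescentDir F x w ∧
    ((PassesTest F P x w ∧ d = w) ∨ (¬ PassesTest F P x w ∧ d = commonDir F x))

/-- `z` is a possible outcome of the refinement of `x` at iteration `k`. -/
def IsRefinement (F : E n → Fin m → ℝ) (P : Params) (k : ℕ) (x z : E n) : Prop :=
  (theta F x < -P.σ k ∧ ∃ d α, IsRefinementDir F P x d ∧
      IsBacktrackingStep P (Armijo F P x d) α ∧ z = x + α • d) ∨
  (¬ theta F x < -P.σ k ∧ z = x)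

/-- Remove from `X` the points that `z` dominates, and add `z`. -/
def update (F : E n → Fin m → ℝ) (X : Set (E n)) (z : E n) : Set (E n) :=
  (X \ {y ∈ X | Dominates F z y}) ∪ {z}

/-- Acceptance of the stepsize `a` along `d` from `z` in the exploration phase. -/
def Acceptable (F : E n → Fin m → ℝ) (X : Set (E n)) (z d : E n) (a : ℝ) : Prop :=
  ∀ y ∈ X, ∃ j, F (z + a • d) j < F y j

/-- `Explore F P z Is X X'`: the inner loop, run from `z` over the subsets listed in `Is`, can
turn the current set `X` into `X'`. -/
inductive Explore (F : E n → Fin m → ℝ) (P : Params) (z : E n) :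
    List (Finset (Fin m)) → Set (E n) → Set (E n) → Prop
  | nil (X : Set (E n)) : Explore F P z [] X X
  | skip (I : Finset (Fin m)) (Is : List (Finset (Fin m))) (X X' : Set (E n)) :
      z ∉ X → Explore F P z Is X X' → Explore F P z (I :: Is) X X'
  | step (I : Finset (Fin m)) (Is : List (Finset (Fin m))) (X X' : Set (E n)) (α : ℝ) :
      z ∈ X → IsBacktrackingStep P (Acceptable F X z (sdDir F I z)) α →
      Explore F P z Is (update F X (z + α • sdDir F I z)) X' →
      Explore F P z (I :: Is) X X'

/-- `Is` lists once each, in some order, the nonempty proper subsets `I` with `θ^I(z) < 0`. -/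
def ListsSubsets (F : E n → Fin m → ℝ) (z : E n) (Is : List (Finset (Fin m))) : Prop :=
  Is.Nodup ∧ ∀ I, I ∈ Is ↔ I.Nonempty ∧ I ⊂ Finset.univ ∧ partialTheta F I z < 0

/-- `Sweep F P k l X X'`: the main loop of iteration `k`, run over the points listed in `l`,
can turn the current set `X` into `X'`. -/
inductive Sweep (F : E n → Fin m → ℝ) (P : Params) (k : ℕ) :
    List (E n) → Set (E n) → Set (E n) → Prop
  | nil (X : Set (E n)) : Sweep F P k [] X X
  | skip (x : E n) (l : List (E n)) (X X' : Set (E n)) :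
      x ∉ X → Sweep F P k l X X' → Sweep F P k (x :: l) X X'
  | step (x : E n) (l : List (E n)) (X X₁ X' : Set (E n)) (z : E n)
      (Is : List (Finset (Fin m))) :
      x ∈ X → IsRefinement F P k x z → ListsSubsets F z Is →
      Explore F P z Is (update F X z) X₁ → Sweep F P k l X₁ X' →
      Sweep F P k (x :: l) X X'

/-- `X 0, X 1, …` is produced by the method, the points of `X k` being scanned in the order
`ord k` at iteration `k`. Each `X k` is finite, since `ord k` lists its points. -/
def IsRun (F : E n → Fin m → ℝ) (P : Params) (X : ℕ → Set (E n)) (ord : ℕ → List (E n)) : Prop :=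
  ∀ k, (ord k).Nodup ∧ (∀ x, x ∈ ord k ↔ x ∈ X k) ∧ Sweep F P k (ord k) (X k) (X (k + 1))

/-- At each iteration the first point to be processed belongs to `argmin_{x ∈ X k} θ(x)`. -/
def LeastStationaryFirst (F : E n → Fin m → ℝ) (X : ℕ → Set (E n)) (ord : ℕ → List (E n)) :
    Prop :=
  ∀ k, ∀ x ∈ (ord k).head?, x ∈ X k ∧ ∀ y ∈ X k, theta F x ≤ theta F y

/-- `ℒ(x₀) = ⋃_j {x | f_j(x) ≤ f_j(x₀)}`. -/
def levelUnion (F : E n → Fin m → ℝ) (x₀ : E n) : Set (E n) :=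
  ⋃ j, {x | F x j ≤ F x₀ j}

end FrontDescent

namespace FrontDescent

variable {n m : ℕ}

/-! ### Mutual nondominance and the dominated region along the method -/

/-! Updates never lose ground: every `X k` stays mutually nondominated, and each later set weakly
dominates each earlier one (`IsRun.covers`). Hence all iterates stay in the compact `levelUnion F
x₀`, which gives accumulation points.

For stationarity, suppose the first processed points `y k` satisfy `θ ≤ -ε` infinitely often. Since
`σ k → 0`, infinitely many of them are refined, and a uniform Armijo estimate on the compact set
lowers every objective by a fixed `η` (`exists_forall_refinement_decrease`). Two such points on a
convergent subsequence have objective values less than `η` apart, so the later one is dominated by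
whatever covers the refinement of the earlier one, contradicting nondominance
(`IsRun.eventually_lt_theta`). The argmin rule carries the lower bound on `θ (y k)` to every `x k`,
and continuity of the gradients carries it to the limit. -/

/-- Every point of `A` is weakly dominated by some point of `B`. -/
def Covers (F : E n → Fin m → ℝ) (B A : Set (E n)) : Prop :=
  ∀ a ∈ A, ∃ b ∈ B, F b ≤ F a

theorem Covers.refl (F : E n → Fin m → ℝ) (A : Set (E n)) : Covers F A A :=
  fun a ha => ⟨a, ha, le_rfl⟩

theorem Covers.trans {F : E n → Fin m → ℝ} {A B C : Set (E n)} (hCB : Covers F C B)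
    (hBA : Covers F B A) : Covers F C A := by
  intro a ha
  obtain ⟨b, hb, hba⟩ := hBA a ha
  obtain ⟨c, hc, hcb⟩ := hCB b hb
  exact ⟨c, hc, hcb.trans hba⟩

theorem mem_update_self (F : E n → Fin m → ℝ) (X : Set (E n)) (z : E n) : z ∈ update F X z :=
  Or.inr rfl

theorem covers_update (F : E n → Fin m → ℝ) (X : Set (E n)) (z : E n) :
    Covers F (update F X z) X := by
  intro a ha
  by_cases h : Dominates F z a
  · exact ⟨z, mem_update_self F X z, h.1⟩
  · exact ⟨a, Or.inl ⟨ha, fun h' => h h'.2⟩, le_rfl⟩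

theorem MutuallyNondominated.update {F : E n → Fin m → ℝ} {X : Set (E n)} {z : E n}
    (hX : MutuallyNondominated F X) (hz : ∀ y ∈ X, ¬ Dominates F y z) :
    MutuallyNondominated F (update F X z) := by
  rintro x (⟨hx, -⟩ | rfl) y (⟨hy, hy'⟩ | rfl) h
  · exact hX x hx y hy h
  · exact hz x hx h
  · exact hy' ⟨hy, h⟩
  · exact h.2 rfl

/-- Anything dominating `z` would also dominate `x`, a member of `X`. -/
theorem MutuallyNondominated.not_dominates_of_le {F : E n → Fin m → ℝ} {X : Set (E n)}
    {x z : E n} (hX : MutuallyNondominated F X) (hx : x ∈ X) (hzx : F z ≤ F x) :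
    ∀ y ∈ X, ¬ Dominates F y z := by
  intro y hy h
  refine hX y hy x hx ⟨h.1.trans hzx, fun he => h.2 (le_antisymm h.1 ?_)⟩
  rw [he]
  exact hzx

/-- An accepted step strictly beats each current point in some objective, so no current point
dominates the trial point. -/
theorem Explore.nondominated_and_covers {F : E n → Fin m → ℝ} {P : Params} {z : E n}
    {Is : List (Finset (Fin m))} {X X' : Set (E n)} (h : Explore F P z Is X X')
    (hX : MutuallyNondominated F X) : MutuallyNondominated F X' ∧ Covers F X' X := by
  induction h with
  | nil X => exact ⟨hX, Covers.refl F X⟩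
  | skip I Is X X' _ _ ih => exact ih hX
  | step I Is X X' α _ hα _ ih =>
    obtain ⟨⟨_, _, hacc⟩, _⟩ := hα
    obtain ⟨h1, h2⟩ := ih <| hX.update fun y hy hdom => by
      obtain ⟨j, hj⟩ := hacc y hy
      exact absurd (hdom.1 j) (not_le.mpr hj)
    exact ⟨h1, h2.trans (covers_update F X _)⟩

/-! ### Steepest descent directions -/

theorem theta_nonpos (F : E n → Fin m → ℝ) (x : E n) : theta F x ≤ 0 := by
  rw [theta, partialTheta_eq]
  refine (sdDir_min F Finset.univ x 0).trans (le_of_eq ?_)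
  simp [sdObjective, maxSlope]

theorem theta_eq (F : E n → Fin m → ℝ) (x : E n) :
    theta F x = slope F x (commonDir F x) + 1 / 2 * ‖commonDir F x‖ ^ 2 :=
  partialTheta_eq F Finset.univ x

theorem theta_le (F : E n → Fin m → ℝ) (x d : E n) :
    theta F x ≤ slope F x d + 1 / 2 * ‖d‖ ^ 2 := by
  rw [theta, partialTheta_eq]
  exact sdDir_min F Finset.univ x d

theorem inner_grad_le_slope (F : E n → Fin m → ℝ) (x d : E n) (j : Fin m) :
    inner ℝ (grad F j x) d ≤ slope F x d :=
  le_maxSlope F x d ⟨j, Finset.mem_univ j⟩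

theorem slope_smul_of_nonneg (F : E n → Fin m → ℝ) (x d : E n) {t : ℝ} (ht : 0 ≤ t) :
    slope F x (t • d) = t * slope F x d := by
  simp only [slope, maxSlope, inner_smul_right, Real.mul_iSup_of_nonneg ht]

theorem slope_zero (F : E n → Fin m → ℝ) (x : E n) : slope F x 0 = 0 := by
  simp [slope, maxSlope]

theorem paretoStationary_of_nonneg {F : E n → Fin m → ℝ} {x : E n}
    (h : ∀ d, 0 ≤ slope F x d + 1 / 2 * ‖d‖ ^ 2) : ParetoStationary F x := by
  refine ⟨⟨0, slope_zero F x⟩, ?_⟩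
  rintro _ ⟨d, rfl⟩
  by_contra! hneg
  set s := slope F x d
  -- Along the ray the quadratic term is of second order: this `t` gives `t * ‖d‖ ^ 2 ≤ -s`, hence
  -- `s + t * ‖d‖ ^ 2 / 2 ≤ s / 2 < 0`.
  set t : ℝ := -s / (‖d‖ ^ 2 + 1) with ht
  have hpos : 0 < ‖d‖ ^ 2 + 1 := by positivity
  have ht0 : 0 < t := div_pos (by linarith) hpos
  have h1 := h (t • d)
  rw [slope_smul_of_nonneg F x d ht0.le, norm_smul, Real.norm_of_nonneg ht0.le] at h1
  have h2 : t * (‖d‖ ^ 2 + 1) = -s := div_mul_cancel₀ _ hpos.ne'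
  have h3 : 0 ≤ t * (s + 1 / 2 * (t * ‖d‖ ^ 2)) := by
    calc 0 ≤ _ := h1
      _ = _ := by simp only [s]; ring
  have h4 := nonneg_of_mul_nonneg_right h3 ht0
  nlinarith

theorem slope_nonpos_of_isRefinementDir {F : E n → Fin m → ℝ} {P : Params} {x d : E n}
    (h : IsRefinementDir F P x d) : slope F x d ≤ 0 := by
  obtain ⟨w, -, ⟨hw, rfl⟩ | ⟨-, rfl⟩⟩ := h
  · have := hw.1
    have := P.Γ₁_pos
    nlinarith [sq_nonneg ‖commonDir F x‖]
  · have := theta_eq F x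
    have := theta_nonpos F x
    nlinarith [sq_nonneg ‖commonDir F x‖]

/-- Where the gradients are bounded by `G` and `θ ≤ -ε`, the selected directions are bounded and
their slopes are bounded away from zero. -/
theorem exists_refinementDir_bounds (m n : ℕ) (hm : 0 < m) (P : Params) {ε G : ℝ} (hε : 0 < ε)
    (hG : 0 < G) :
    ∃ c > 0, ∃ R > 0, ∀ (F : E n → Fin m → ℝ) (x d : E n), (∀ j, ‖grad F j x‖ ≤ G) →
      theta F x ≤ -ε → IsRefinementDir F P x d → slope F x d ≤ -c ∧ ‖d‖ ≤ R := by
  have h₁ := P.Γ₁_pos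
  have h₂ := P.Γ₂_pos
  refine ⟨min (P.Γ₁ * (ε / G) ^ 2) ε, by positivity, max P.Γ₂ 1 * (2 * G), by positivity, ?_⟩
  intro F x d hg hθ hd
  set v := commonDir F x with hv
  have hlow : -(G * ‖v‖) ≤ slope F x v := by
    refine le_trans ?_ (inner_grad_le_slope F x v ⟨0, hm⟩)
    have := neg_le_of_abs_le (abs_real_inner_le_norm (grad F ⟨0, hm⟩ x) v)
    nlinarith [hg ⟨0, hm⟩, norm_nonneg v]
  have hθv : theta F x = slope F x v + 1 / 2 * ‖v‖ ^ 2 := theta_eq F x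
  -- Both bounds on `‖v‖` come from `-G‖v‖ + ‖v‖²/2 ≤ θ ≤ -ε`.
  have hv_low : ε / G ≤ ‖v‖ := by
    rw [div_le_iff₀ hG]
    nlinarith [sq_nonneg ‖v‖]
  have hv_up : ‖v‖ ≤ 2 * G := by
    by_contra! hlt
    nlinarith [norm_nonneg v]
  obtain ⟨w, -, ⟨hw, rfl⟩ | ⟨-, rfl⟩⟩ := hd
  · constructor
    · have hsq : (ε / G) ^ 2 ≤ ‖v‖ ^ 2 := pow_le_pow_left₀ (by positivity) hv_low 2
      have hw1 : slope F x d ≤ -P.Γ₁ * ‖v‖ ^ 2 := hw.1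
      have := min_le_left (P.Γ₁ * (ε / G) ^ 2) ε
      nlinarith
    · calc ‖d‖ ≤ P.Γ₂ * ‖v‖ := hw.2
        _ ≤ max P.Γ₂ 1 * (2 * G) := by gcongr; exact le_max_left _ _
  · constructor
    · have := min_le_right (P.Γ₁ * (ε / G) ^ 2) ε
      nlinarith [sq_nonneg ‖v‖]
    · calc ‖v‖ = 1 * ‖v‖ := (one_mul _).symm
        _ ≤ max P.Γ₂ 1 * (2 * G) := by gcongr; exact le_max_right _ _

/-! ### Gradients of continuously differentiable objectives -/

theorem inner_grad_eq_fderiv (F : E n → Fin m → ℝ) (j : Fin m) (x d : E n) :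
    inner ℝ (grad F j x) d = fderiv ℝ (fun y => F y j) x d := by
  rw [grad, ← toDual_gradient, InnerProductSpace.toDual_apply_apply]

theorem norm_grad_eq_norm_fderiv (F : E n → Fin m → ℝ) (j : Fin m) (x : E n) :
    ‖grad F j x‖ = ‖fderiv ℝ (fun y => F y j) x‖ := by
  rw [grad, ← toDual_gradient, LinearIsometryEquiv.norm_map]

theorem continuous_fderiv_component {F : E n → Fin m → ℝ} (hF : ContDiff ℝ 1 F) (j : Fin m) :
    Continuous (fderiv ℝ fun y => F y j) :=
  (contDiff_pi.mp hF j).continuous_fderiv one_ne_zero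

theorem continuous_slope_left {F : E n → Fin m → ℝ} (hF : ContDiff ℝ 1 F) (hm : 0 < m)
    (d : E n) : Continuous fun x => slope F x d := by
  have : Nonempty (Finset.univ : Finset (Fin m)) := ⟨⟨⟨0, hm⟩, Finset.mem_univ _⟩⟩
  have h : (fun x => slope F x d) = fun x => Finset.univ.sup' Finset.univ_nonempty
      (fun j : (Finset.univ : Finset (Fin m)) => fderiv ℝ (fun y => F y j) x d) := by
    funext x
    simp only [slope, maxSlope, Finset.sup'_univ_eq_ciSup, inner_grad_eq_fderiv]
  rw [h]
  exact Continuous.finset_sup'_apply _ fun j _ =>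
    (continuous_fderiv_component hF j).clm_apply continuous_const

theorem exists_norm_grad_le {F : E n → Fin m → ℝ} (hF : ContDiff ℝ 1 F) {K : Set (E n)}
    (hK : IsCompact K) : ∃ G > 0, ∀ x ∈ K, ∀ j, ‖grad F j x‖ ≤ G := by
  choose C hC using fun j =>
    hK.exists_bound_of_continuousOn (continuous_fderiv_component hF j).continuousOn
  refine ⟨1 + ∑ j, |C j|, by positivity, fun x hx j => ?_⟩
  have h1 := Finset.single_le_sum (f := fun j => |C j|) (fun i _ => abs_nonneg _)
    (Finset.mem_univ j)
  rw [norm_grad_eq_norm_fderiv]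
  linarith [hC j x hx, le_abs_self (C j)]

/-- Only the base point must lie in `K`; trial points may leave it. -/
theorem exists_forall_norm_fderiv_sub_le {F : E n → Fin m → ℝ} (hF : ContDiff ℝ 1 F)
    {K : Set (E n)} (hK : IsCompact K) {η : ℝ} (hη : 0 < η) :
    ∃ ρ > 0, ∀ x ∈ K, ∀ y ∈ Metric.ball x ρ, ∀ j,
      ‖fderiv ℝ (fun y => F y j) y - fderiv ℝ (fun y => F y j) x‖ ≤ η := by
  have h : ∀ᶠ p : E n × E n in uniformity (E n), ∀ j, p.1 ∈ K →
      (fderiv ℝ (fun y => F y j) p.1, fderiv ℝ (fun y => F y j) p.2) ∈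
        {q : (E n →L[ℝ] ℝ) × (E n →L[ℝ] ℝ) | dist q.1 q.2 < η} :=
    eventually_all.mpr fun j => hK.uniformContinuousAt_of_continuousAt _
      (fun a _ => (continuous_fderiv_component hF j).continuousAt) (Metric.dist_mem_uniformity hη)
  obtain ⟨ρ, hρ, hb⟩ := Metric.mem_uniformity_dist.mp h
  refine ⟨ρ, hρ, fun x hx y hy j => ?_⟩
  have h1 : dist _ _ < η := hb (a := x) (b := y) (by rwa [dist_comm]) j hx
  rw [← dist_eq_norm, dist_comm]
  exact h1.le

/-- The Armijo condition holds for all small stepsizes, uniformly over base points in a compact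
set and bounded directions with slope bounded away from zero. -/
theorem exists_forall_armijo {F : E n → Fin m → ℝ} (hF : ContDiff ℝ 1 F) (P : Params)
    {K : Set (E n)} (hK : IsCompact K) {c R : ℝ} (hc : 0 < c) (hR : 0 < R) :
    ∃ a₀ > 0, ∀ x ∈ K, ∀ d, slope F x d ≤ -c → ‖d‖ ≤ R → ∀ a, 0 < a → a < a₀ →
      Armijo F P x d a := by
  have hγ := P.γ_lt_one
  -- With this tolerance the linearization error is at most `(1 - γ) * c * a`, the slack that Armijo
  -- leaves when the slope is at most `-c`.
  obtain ⟨ρ, hρ, hb⟩ := exists_forall_norm_fderiv_sub_le hF hK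
    (η := (1 - P.γ) * c / R) (div_pos (mul_pos (by linarith) hc) hR)
  refine ⟨ρ / R, by positivity, fun x hx d hd hdR a ha haρ j => ?_⟩
  have hnorm : ‖a • d‖ ≤ a * R := by
    rw [norm_smul, Real.norm_of_nonneg ha.le]
    gcongr
  have hmem : x + a • d ∈ Metric.ball x ρ := by
    rw [mem_ball_iff_norm, add_sub_cancel_left]
    exact hnorm.trans_lt ((lt_div_iff₀ hR).mp haρ)
  have h1 := Convex.norm_image_sub_le_of_norm_fderiv_le' (𝕜 := ℝ) (f := fun y => F y j)
    (fun y _ => (contDiff_pi.mp hF j).differentiable one_ne_zero y)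
    (fun y hy => hb x hx y hy j) (convex_ball x ρ) (Metric.mem_ball_self hρ) hmem
  rw [add_sub_cancel_left, map_smul, smul_eq_mul, ← inner_grad_eq_fderiv] at h1
  have h2 := (le_abs_self _).trans h1
  have h3 : (1 - P.γ) * c / R * ‖a • d‖ ≤ (1 - P.γ) * c * a := by
    calc (1 - P.γ) * c / R * ‖a • d‖ ≤ (1 - P.γ) * c / R * (a * R) := by
          gcongr
      _ = (1 - P.γ) * c * a := by field_simp
  have h4 : a * inner ℝ (grad F j x) d ≤ a * slope F x d := by
    gcongr
    exact inner_grad_le_slope F x d j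
  have h5 : 0 ≤ (1 - P.γ) * a * (-c - slope F x d) :=
    mul_nonneg (mul_nonneg (by linarith) ha.le) (by linarith)
  nlinarith

/-! ### Sufficient decrease -/

theorem IsBacktrackingStep.pos {P : Params} {A : ℝ → Prop} {α : ℝ}
    (h : IsBacktrackingStep P A α) : 0 < α := by
  obtain ⟨⟨k, rfl, -⟩, -⟩ := h
  exact mul_pos P.α₀_pos (pow_pos P.δ_pos k)

theorem IsBacktrackingStep.prop {P : Params} {A : ℝ → Prop} {α : ℝ}
    (h : IsBacktrackingStep P A α) : A α := by
  obtain ⟨⟨k, -, hA⟩, -⟩ := h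
  exact hA

/-- Unless `α = α₀`, the previous trial `α / δ` was rejected, so it is at least `a₀`. -/
theorem IsBacktrackingStep.le {P : Params} {A : ℝ → Prop} {α a₀ : ℝ}
    (h : IsBacktrackingStep P A α) (hA : ∀ a, 0 < a → a < a₀ → A a) :
    min P.α₀ (P.δ * a₀) ≤ α := by
  obtain ⟨⟨k, rfl, -⟩, hmax⟩ := h
  have h0 := P.α₀_pos
  have hδ := P.δ_pos
  rcases k with _ | k
  · simp
  · refine min_le_of_right_le ?_
    by_contra! hlt
    have hlt' : P.α₀ * P.δ ^ k < a₀ := by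
      refine lt_of_mul_lt_mul_left (a := P.δ) ?_ hδ.le
      calc P.δ * (P.α₀ * P.δ ^ k) = P.α₀ * P.δ ^ (k + 1) := by ring
        _ < P.δ * a₀ := hlt
    have h1 : P.α₀ * P.δ ^ k ≤ P.α₀ * P.δ ^ (k + 1) :=
      hmax ⟨k, rfl, hA _ (by positivity) hlt'⟩
    have h2 : 0 < P.α₀ * P.δ ^ k := by positivity
    rw [pow_succ] at h1
    nlinarith [P.δ_lt_one]

theorem IsRefinement.le {F : E n → Fin m → ℝ} {P : Params} {k : ℕ} {x z : E n}
    (h : IsRefinement F P k x z) : F z ≤ F x := by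
  rcases h with ⟨-, d, α, hd, hα, rfl⟩ | ⟨-, rfl⟩
  · intro j
    have h1 := hα.prop j
    have h2 : P.γ * α * slope F x d ≤ 0 :=
      mul_nonpos_of_nonneg_of_nonpos (mul_pos P.γ_pos hα.pos).le
        (slope_nonpos_of_isRefinementDir hd)
    linarith
  · exact le_rfl

/-- Refining a point of a compact set where `θ ≤ -ε < -σ_k` decreases all the objectives by a
uniform amount. -/
theorem exists_forall_refinement_decrease {F : E n → Fin m → ℝ} (hF : ContDiff ℝ 1 F)
    (hm : 0 < m) (P : Params) {K : Set (E n)} (hK : IsCompact K) {ε : ℝ} (hε : 0 < ε) :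
    ∃ η > 0, ∀ k, ∀ x ∈ K, ∀ z, P.σ k < ε → theta F x ≤ -ε → IsRefinement F P k x z →
      ∀ j, F z j ≤ F x j - η := by
  obtain ⟨G, hG, hgrad⟩ := exists_norm_grad_le hF hK
  obtain ⟨c, hc, R, hR, hdir⟩ := exists_refinementDir_bounds m n hm P hε hG
  obtain ⟨a₀, ha₀, harm⟩ := exists_forall_armijo hF P hK hc hR
  have hα₀ := P.α₀_pos
  have hδ := P.δ_pos
  have hγ := P.γ_pos
  refine ⟨P.γ * min P.α₀ (P.δ * a₀) * c, by positivity, fun k x hx z hσ hθ hz j => ?_⟩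
  rcases hz with ⟨-, d, α, hd, hα, rfl⟩ | ⟨h, -⟩
  · obtain ⟨hslope, hnorm⟩ := hdir F x d (hgrad x hx) hθ hd
    have h1 := hα.prop j
    have h2 := hα.le (harm x hx d hslope hnorm)
    have h3 : P.γ * min P.α₀ (P.δ * a₀) * c ≤ P.γ * α * (-slope F x d) := by
      have := hα.pos
      gcongr
      linarith
    linarith
  -- `θ ≤ -ε < -σ k` rules out the branch without refinement.
  · exact absurd (by linarith) h

/-! ### Properties of runs -/

theorem Sweep.nondominated_and_covers {F : E n → Fin m → ℝ} {P : Params} {k : ℕ}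
    {l : List (E n)} {X X' : Set (E n)} (h : Sweep F P k l X X')
    (hX : MutuallyNondominated F X) : MutuallyNondominated F X' ∧ Covers F X' X := by
  induction h with
  | nil X => exact ⟨hX, Covers.refl F X⟩
  | skip x l X X' _ _ ih => exact ih hX
  | step x l X X₁ X' z Is hx hz _ hexp _ ih =>
    obtain ⟨h1, h2⟩ := hexp.nondominated_and_covers
      (hX.update (hX.not_dominates_of_le hx hz.le))
    obtain ⟨h3, h4⟩ := ih h1
    exact ⟨h3, h4.trans (h2.trans (covers_update F X z))⟩

/-- Nothing is removed before the first turn, so the head is not skipped. Its refinement `z` may be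
removed later; `y` stands in for it. -/
theorem Sweep.exists_refinement_head {F : E n → Fin m → ℝ} {P : Params} {k : ℕ} {x : E n}
    {l : List (E n)} {X X' : Set (E n)} (h : Sweep F P k (x :: l) X X')
    (hX : MutuallyNondominated F X) (hx : x ∈ X) :
    ∃ z, IsRefinement F P k x z ∧ ∃ y ∈ X', F y ≤ F z := by
  cases h with
  | skip _ _ _ _ hx' _ => exact absurd hx hx'
  | step _ _ _ X₁ _ z Is _ hz _ hexp hs =>
    obtain ⟨h1, h2⟩ := hexp.nondominated_and_covers
      (hX.update (hX.not_dominates_of_le hx hz.le))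
    exact ⟨z, hz, ((hs.nondominated_and_covers h1).2.trans h2) z (mem_update_self F X z)⟩

theorem IsRun.mutuallyNondominated {F : E n → Fin m → ℝ} {P : Params} {X : ℕ → Set (E n)}
    {ord : ℕ → List (E n)} (hrun : IsRun F P X ord) (hX₀ : MutuallyNondominated F (X 0)) (k : ℕ) :
    MutuallyNondominated F (X k) := by
  induction k with
  | zero => exact hX₀
  | succ k ih => exact ((hrun k).2.2.nondominated_and_covers ih).1

theorem IsRun.covers {F : E n → Fin m → ℝ} {P : Params} {X : ℕ → Set (E n)}
    {ord : ℕ → List (E n)} (hrun : IsRun F P X ord) (hX₀ : MutuallyNondominated F (X 0))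
    {k l : ℕ} (hkl : k ≤ l) : Covers F (X l) (X k) := by
  induction l, hkl using Nat.le_induction with
  | base => exact Covers.refl F _
  | succ l _ ih =>
    exact ((hrun l).2.2.nondominated_and_covers (hrun.mutuallyNondominated hX₀ l)).2.trans ih

theorem IsRun.subset_levelUnion {F : E n → Fin m → ℝ} {P : Params} {X : ℕ → Set (E n)}
    {ord : ℕ → List (E n)} (hrun : IsRun F P X ord) (hX₀ : MutuallyNondominated F (X 0))
    (hm : 0 < m) {x₀ : E n} (hx₀ : x₀ ∈ X 0) (k : ℕ) : X k ⊆ levelUnion F x₀ := by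
  intro x hx
  obtain ⟨y, hy, hyx₀⟩ := hrun.covers hX₀ (Nat.zero_le k) x₀ hx₀
  simp only [levelUnion, Set.mem_iUnion, Set.mem_ofPred_eq]
  by_contra! hlt
  have hyx : ∀ j, F y j < F x j := fun j => (hyx₀ j).trans_lt (hlt j)
  exact hrun.mutuallyNondominated hX₀ k y hy x hx
    ⟨fun j => (hyx j).le, fun he => (hyx ⟨0, hm⟩).ne (congrFun he _)⟩

/-- The stationarity measure of the points first processed cannot stay away from zero. -/
theorem IsRun.eventually_lt_theta {F : E n → Fin m → ℝ} (hF : ContDiff ℝ 1 F) (hm : 0 < m)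
    {P : Params} (hσ : Tendsto P.σ atTop (𝓝 0)) {X : ℕ → Set (E n)} {ord : ℕ → List (E n)}
    (hrun : IsRun F P X ord) (hX₀ : MutuallyNondominated F (X 0)) {K : Set (E n)}
    (hK : IsCompact K) (hXK : ∀ k, X k ⊆ K) {y : ℕ → E n} (hy : ∀ k, y k ∈ (ord k).head?)
    {ε : ℝ} (hε : 0 < ε) : ∀ᶠ k in atTop, -ε < theta F (y k) := by
  have hyX : ∀ k, y k ∈ X k := fun k => ((hrun k).2.1 _).mp (List.mem_of_mem_head? (hy k))
  obtain ⟨η, hη, hdec⟩ := exists_forall_refinement_decrease hF hm P hK hε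
  by_contra hcon
  have hfreq : ∃ᶠ k in atTop, theta F (y k) ≤ -ε ∧ P.σ k < ε := by
    refine Frequently.and_eventually ?_ (hσ.eventually_lt_const hε)
    simpa only [Filter.not_eventually, not_lt] using hcon
  obtain ⟨φ, hφ, hφP⟩ := extraction_of_frequently_atTop hfreq
  obtain ⟨a, -, ψ, hψ, hlim⟩ := hK.tendsto_subseq fun i => hXK _ (hyX (φ i))
  have hlimF : Tendsto (fun i => F (y (φ (ψ i)))) atTop (𝓝 (F a)) :=
    (hF.continuous.tendsto a).comp hlim
  have hclose : ∀ᶠ i in atTop, ∀ j, |F (y (φ (ψ i))) j - F a j| < η / 2 :=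
    eventually_all.mpr fun j => by
      have h := Metric.tendsto_nhds.mp (tendsto_pi_nhds.mp hlimF j) (η / 2) (by positivity)
      simpa only [Real.dist_eq] using h
  obtain ⟨N, hN⟩ := eventually_atTop.mp hclose
  set p := φ (ψ N) with hp
  set q := φ (ψ (N + 1)) with hq
  -- The refinement made at iteration `p` is covered only from `X (p + 1)` on.
  have hpq : p + 1 ≤ q := hφ (hψ N.lt_succ_self)
  obtain ⟨l, hl⟩ : ∃ l, ord p = y p :: l := ⟨_, (List.eq_cons_of_mem_head? (hy p))⟩
  have hsweep := (hrun p).2.2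
  rw [hl] at hsweep
  obtain ⟨z, hz, w, hw, hwz⟩ :=
    hsweep.exists_refinement_head (hrun.mutuallyNondominated hX₀ p) (hyX p)
  obtain ⟨u, hu, huw⟩ := hrun.covers hX₀ hpq w hw
  have hlt : ∀ j, F u j < F (y q) j := by
    intro j
    have h1 := hdec p (y p) (hXK p (hyX p)) z (hφP (ψ N)).2 (hφP (ψ N)).1 hz j
    have h2 := abs_lt.mp (hN N le_rfl j)
    have h3 := abs_lt.mp (hN (N + 1) N.le_succ j)
    linarith [huw j, hwz j, h2.1, h2.2, h3.1, h3.2]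
  exact hrun.mutuallyNondominated hX₀ q u hu (y q) (hyX q)
    ⟨fun j => (hlt j).le, fun he => (hlt ⟨0, hm⟩).ne (congrFun he _)⟩

/-- A cluster point of a sequence along which `θ` is asymptotically nonnegative is
Pareto-stationary. -/
theorem paretoStationary_of_mapClusterPt {F : E n → Fin m → ℝ} (hF : ContDiff ℝ 1 F)
    (hm : 0 < m) {x : ℕ → E n} (hx : ∀ ε > 0, ∀ᶠ k in atTop, -ε < theta F (x k)) {xbar : E n}
    (hbar : MapClusterPt xbar atTop x) : ParetoStationary F xbar := by
  refine paretoStationary_of_nonneg fun d => ?_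
  obtain ⟨ψ, hψ, hlim⟩ := hbar.tendsto_subseq
  -- Fixing `d` and bounding `θ` by its objective at `d` avoids continuity of `θ`.
  have hlim' := ((continuous_slope_left hF hm d).tendsto xbar).comp hlim
  refine le_of_forall_pos_le_add fun ε hε => ?_
  have h := ge_of_tendsto (b := -ε - 1 / 2 * ‖d‖ ^ 2) hlim' <| by
    filter_upwards [hψ.tendsto_atTop.eventually (hx ε hε)] with k hk
    have := theta_le F (x (ψ k)) d
    simp only [Function.comp_apply]
    linarith
  linarith

end FrontDescent

theorem mainTheorem3 {n m : ℕ} (hm : 0 < m)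
    (F : FrontDescent.E n → Fin m → ℝ) (hF : ContDiff ℝ 1 F)
    (P : FrontDescent.Params) (hσ : Tendsto P.σ atTop (𝓝 0))
    (X : ℕ → Set (FrontDescent.E n)) (ord : ℕ → List (FrontDescent.E n))
    (hX₀ : FrontDescent.MutuallyNondominated F (X 0))
    (x₀ : FrontDescent.E n) (hx₀ : x₀ ∈ X 0)
    (hcompact : IsCompact (FrontDescent.levelUnion F x₀))
    (hrun : FrontDescent.IsRun F P X ord)
    (hfirst : FrontDescent.LeastStationaryFirst F X ord)
    (x : ℕ → FrontDescent.E n) (hx : ∀ k, x k ∈ X k) :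
    (∃ xbar, MapClusterPt xbar atTop x) ∧
      ∀ xbar, MapClusterPt xbar atTop x → FrontDescent.ParetoStationary F xbar := by
  have hXK := hrun.subset_levelUnion hX₀ hm hx₀
  constructor
  · obtain ⟨a, -, ha⟩ := hcompact.exists_mapClusterPt (f := atTop) (u := x)
      (tendsto_principal.mpr (Eventually.of_forall fun k => hXK k (hx k)))
    exact ⟨a, ha⟩
  · have hhead : ∀ k, ∃ y, y ∈ (ord k).head? := fun k => by
      have hmem := ((hrun k).2.1 (x k)).mpr (hx k)
      exact ⟨_, List.head?_eq_some_head (List.ne_nil_of_mem hmem)⟩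
    choose y hy using hhead
    intro xbar hbar
    refine FrontDescent.paretoStationary_of_mapClusterPt hF hm (fun ε hε => ?_) hbar
    filter_upwards [hrun.eventually_lt_theta hF hm hσ hX₀ hcompact hXK hy hε] with k hk
    exact hk.trans_le ((hfirst k (y k) (hy k)).2 (x k) (hx k))
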